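/- **Theorem 4.1 (Slepian-type inequality for elliptical vectors).** Write $\mathbf X\sim E_n(\boldsymbol\mu,\boldsymbol\Sigma,\phi)$ if $\mathbf X$ is a random vector in $\mathbb R^n$ with characteristic function $\mathbf t\mapsto e^{i\mathbf t'\boldsymbol\mu}\phi(\mathbf t'\boldsymbol\Sigma\mathbf t)$, where $\boldsymbol\mu\in\mathbb R^n$, $\boldsymbol\Sigma$ is a symmetric positive semidefinite (possibly singular) $n\times n$ matrix, and $\phi$ is such that $\mathbf t\mapsto\phi(\|\mathbf t\|^2)$ is the characteristic function of a probability distribution on $\mathbb R^n$. Let $\mathbf X\sim E_n(\boldsymbol\mu^x,\boldsymbol\Sigma^x,\phi)$ and $\mathbf Y\sim E_n(\boldsymbol\mu^y,\boldsymbol\Sigma^y,\phi)$ with $\boldsymbol\Sigma^x=(\sigma^x_{ij})$, $\boldsymbol\Sigma^y=(\sigma^y_{ij})$. Suppose that $X_i$ and $Y_i$ have the same distribution for each $i$ and that $\sigma^x_{ij}\le\sigma^y_{ij}$ for all $1\le i<j\le n$. Then for every $\mathbf a\in\mathbb R^n$ $$P(X_1\le a_1,\dots,X_n\le a_n)\le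 P(Y_1\le a_1,\dots,Y_n\le a_n),$$ $$P(X_1>a_1,\dots,X_n>a_n)\le P(Y_1>a_1,\dots,Y_n>a_n).$$ Furthermore, both inequalities are strict for every $\mathbf a\in\mathbb R^n$ if $\sigma^x_{ij}<\sigma^y_{ij}$ for some $i,j$, the supports of $\mathbf X$ and $\mathbf Y$ are unbounded, and $\boldsymbol\Sigma^x+\boldsymbol\Sigma^y$ is positive definite (for instance, if at least one of $\boldsymbol\Sigma^x,\boldsymbol\Sigma^y$ is nonsingular). -/

import Mathlib

open MeasureTheory ProbabilityTheory Matrix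

/-- The class `Ψ_n` of characteristic generators: `φ(t₁² + ⋯ + t_n²)` is the characteristic function
of a probability distribution on `ℝⁿ` (in particular `φ 0 = 1`).  Only the values of `φ` on
`[0, ∞)` matter. -/
def IsCharacteristicGenerator (n : ℕ) (φ : ℝ → ℝ) : Prop :=
  ∃ ν : Measure (EuclideanSpace ℝ (Fin n)), IsProbabilityMeasure ν ∧
    ∀ t : EuclideanSpace ℝ (Fin n), charFun ν t = (φ (‖t‖ ^ 2) : ℂ)

/-- `X ∼ E_n(m, S, φ)` under `P`: the random vector `X` has the characteristic function
`t ↦ exp(i t'm) φ(t'St)`, where `φ ∈ Ψ_n` and the dispersion matrix `S` is symmetric and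
positive semidefinite (possibly singular). -/
structure IsElliptical {Ω : Type*} [MeasurableSpace Ω] {n : ℕ}
    (X : Ω → EuclideanSpace ℝ (Fin n)) (P : Measure Ω)
    (m : EuclideanSpace ℝ (Fin n)) (S : Matrix (Fin n) (Fin n) ℝ) (φ : ℝ → ℝ) : Prop where
  aemeasurable : AEMeasurable X P
  generator : IsCharacteristicGenerator n φ
  posSemidef : S.PosSemidef
  charFun_eq : ∀ t : EuclideanSpace ℝ (Fin n),
    charFun (P.map X) t =
      Complex.exp (Complex.I * ((t.ofLp ⬝ᵥ m.ofLp : ℝ) : ℂ)) * (φ (t.ofLp ⬝ᵥ (S *ᵥ t.ofLp)) : ℂ)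

/-
A centred elliptical vector with dispersion matrix `S` has the law of `(⟪v i, z⟫)_i`, where `z` is
spherically symmetric and the `v i` have Gram matrix `S`. Increasing the row and the column `k` off
the diagonal amounts to replacing `v k` by a vector `w` of the same norm with larger inner products
with the other `v j`. The reflection exchanging `v k` and `w` preserves the law of `z`, and it maps
every point that lies in the box before the replacement but not afterwards to a point that lies in
the box afterwards but not before, so the probability of the box does not decrease. A general
increase of the dispersion matrix is cut into steps small enough that every intermediate matrix,
with one row and column at a time raised, stays positive definite; singular matrices are limits of
regular ones. Strictness comes from one such row step at the midpoint `(S + T) / 2`: far out along a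
suitable ray a neighbourhood is won by the exchange, and the unbounded support charges it.
-/

open Filter Topology Function
open scoped RealInnerProductSpace

section Spherical

variable {E : Type*} [NormedAddCommGroup E] [InnerProductSpace ℝ E] {e : E}

/-- The reflection in the hyperplane orthogonal to `x - y`; it exchanges `x` and `y` when they have
the same norm. -/
noncomputable def exchange (x y : E) : E ≃ₗᵢ[ℝ] E :=
  (ℝ ∙ (x - y))ᗮ.reflection

theorem exchange_exchange (x y z : E) : exchange x y (exchange x y z) = z :=
  Submodule.reflection_reflection _ z

theorem exchange_left {x y : E} (h : ‖x‖ = ‖y‖) : exchange x y x = y :=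
  Submodule.reflection_sub h

theorem exchange_right {x y : E} (h : ‖x‖ = ‖y‖) : exchange x y y = x := by
  simpa only [exchange_left h] using exchange_exchange x y x

theorem exchange_sub {x y : E} (h : ‖x‖ = ‖y‖) : exchange x y (x - y) = -(x - y) := by
  rw [map_sub, exchange_left h, exchange_right h, neg_sub]

theorem inner_exchange (x y u z : E) : ⟪u, exchange x y z⟫ = ⟪exchange x y u, z⟫ := by
  rw [LinearIsometryEquiv.inner_map_eq_flip, exchange, Submodule.reflection_symm]

theorem inner_le_inner_exchange {x y u z : E} (hz : ⟪x - y, z⟫ ≤ 0) (hu : ⟪u, x - y⟫ ≤ 0) :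
    ⟪u, exchange x y z⟫ ≤ ⟪u, z⟫ := by
  have h : ⟪u, exchange x y z⟫ = ⟪u, z⟫ - 2 * (⟪x - y, z⟫ / ‖x - y‖ ^ 2 * ⟪u, x - y⟫) := by
    rw [exchange, Submodule.reflection_orthogonal_apply, Submodule.reflection_singleton_apply,
      neg_sub, inner_sub_right, two_smul, inner_add_right, real_inner_smul_right]
    simp only [RCLike.ofReal_real_eq_id, id]
    ring
  have hnn : 0 ≤ ⟪x - y, z⟫ / ‖x - y‖ ^ 2 * ⟪u, x - y⟫ :=
    mul_nonneg_of_nonpos_of_nonpos (div_nonpos_of_nonpos_of_nonneg hz (by positivity)) hu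
  linarith

/-- The neighbourhoods of the far end of the ray `{r • e | 0 ≤ r}`: the sets which are
neighbourhoods of `r • e` for all large `r`. -/
def rayFilter (e : E) : Filter E :=
  atTop.bind fun r : ℝ => 𝓝 (r • e)

theorem mem_rayFilter {s : Set E} : s ∈ rayFilter e ↔ ∀ᶠ r : ℝ in atTop, s ∈ 𝓝 (r • e) :=
  mem_bind'

theorem tendsto_inner_rayFilter_atTop {v : E} (h : 0 < ⟪v, e⟫) :
    Tendsto (fun z => ⟪v, z⟫) (rayFilter e) atTop := by
  refine tendsto_atTop.2 fun c => mem_rayFilter.2 ?_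
  filter_upwards [(tendsto_id.atTop_mul_const h).eventually_gt_atTop c] with r hr
  have hc : Continuous fun z : E => ⟪v, z⟫ := by fun_prop
  filter_upwards [hc.continuousAt.eventually_const_lt
    (show c < ⟪v, r • e⟫ by rwa [real_inner_smul_right])] with z hz using hz.le

theorem tendsto_inner_rayFilter_atBot {v : E} (h : ⟪v, e⟫ < 0) :
    Tendsto (fun z => ⟪v, z⟫) (rayFilter e) atBot := by
  simpa [comp_def] using tendsto_neg_atTop_atBot.comp
    (tendsto_inner_rayFilter_atTop (show 0 < ⟪-v, e⟫ by simpa using h))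

variable [MeasurableSpace E] {ν : Measure E}

theorem charFun_map_of_inner_eq {F : Type*} [NormedAddCommGroup F] [InnerProductSpace ℝ F]
    [SecondCountableTopology F] [MeasurableSpace F] [BorelSpace F] {f : E → F} (hf : Measurable f)
    {f' : F → E} (h : ∀ z t, ⟪f z, t⟫ = ⟪z, f' t⟫) (t : F) :
    charFun (ν.map f) t = charFun ν (f' t) := by
  rw [charFun_apply, charFun_apply, integral_map hf.aemeasurable (by fun_prop)]
  simp only [h]

/-- Spherical symmetry: invariance of a measure under all linear isometries. -/
def IsRotationInvariant (ν : Measure E) : Prop :=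
  ∀ g : E ≃ₗᵢ[ℝ] E, MeasurePreserving g ν ν

variable [BorelSpace E]

theorem IsRotationInvariant.measure_preimage (hν : IsRotationInvariant ν) (g : E ≃ₗᵢ[ℝ] E)
    (s : Set E) : ν (g ⁻¹' s) = ν s :=
  MeasurePreserving.measure_preimage_equiv (f := g.toMeasurableEquiv) (hν g) s

theorem isRotationInvariant_of_charFun_eq [CompleteSpace E] [SecondCountableTopology E]
    [IsFiniteMeasure ν] (h : ∀ s t : E, ‖s‖ = ‖t‖ → charFun ν s = charFun ν t) :
    IsRotationInvariant ν := by
  refine fun g => ⟨g.continuous.measurable, Measure.ext_of_charFun (funext fun t => ?_)⟩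
  rw [charFun_map_of_inner_eq g.continuous.measurable g.inner_map_eq_flip]
  exact h _ _ (g.symm.norm_map t)

theorem IsRotationInvariant.measure_pos_of_mem_rayFilter (hν : IsRotationInvariant ν)
    (hb : ¬ Bornology.IsBounded ν.support) (he : e ≠ 0) {s : Set E} (hs : s ∈ rayFilter e) :
    0 < ν s := by
  obtain ⟨R, hR⟩ := eventually_atTop.1 (mem_rayFilter.1 hs)
  obtain ⟨z, hz, hzR⟩ : ∃ z ∈ ν.support, max R 0 * ‖e‖ < ‖z‖ := by
    by_contra! h
    exact hb (isBounded_iff_forall_norm_le.2 ⟨_, h⟩)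
  have he' : 0 < ‖e‖ := norm_pos_iff.2 he
  set r := ‖z‖ / ‖e‖
  have hr : max R 0 ≤ r := (le_div_iff₀ he').2 hzR.le
  have hnorm : ‖z‖ = ‖r • e‖ := by
    rw [norm_smul, Real.norm_of_nonneg (by positivity), div_mul_cancel₀ _ he'.ne']
  set g := exchange z (r • e)
  have hg : g z = r • e := exchange_left hnorm
  have hs' : s ∈ 𝓝 (g z) := by
    rw [hg]
    exact hR r ((le_max_left _ _).trans hr)
  rw [← hν.measure_preimage g]
  exact (Measure.mem_support_iff_forall z).1 hz _ (g.continuous.continuousAt.preimage_mem_nhds hs')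

end Spherical

section Exchange

variable {E : Type*} [NormedAddCommGroup E] [InnerProductSpace ℝ E] {ι : Type*}

/-- The points whose inner products with the vectors `v i` lie in the sets `L i`: the event that a
linear image of a random point of `E` falls into a box. -/
def innerBox (v : ι → E) (L : ι → Set ℝ) : Set E :=
  {z | ∀ i, ⟪v i, z⟫ ∈ L i}

variable {v : ι → E} {w f : E} {k l : ι} {L : ι → Set ℝ}

theorem preimage_innerBox (g : E ≃ₗᵢ[ℝ] E) :
    g ⁻¹' innerBox (fun i => g (v i)) L = innerBox v L := by
  simp only [innerBox, Set.preimage_ofPred_eq, LinearIsometryEquiv.inner_map_map]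

theorem measurableSet_innerBox [Countable ι] [MeasurableSpace E] [OpensMeasurableSpace E]
    (hL : ∀ i, MeasurableSet (L i)) : MeasurableSet (innerBox v L) := by
  rw [innerBox, Set.ofPred_forall]
  exact .iInter fun i => (by fun_prop : Continuous fun z : E => ⟪v i, z⟫).measurable (hL i)

theorem measurableSet_innerBox_of_isLowerSet [Countable ι] [MeasurableSpace E]
    [OpensMeasurableSpace E] (hL : ∀ i, IsLowerSet (L i)) : MeasurableSet (innerBox v L) :=
  measurableSet_innerBox fun i => (hL i).ordConnected.measurableSet

theorem exists_exchange_direction (hf : ∀ i, ⟪v i, f⟫ < 0) (hw : ‖v k‖ = ‖w‖)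
    (hvw : ∀ j ≠ k, ⟪v j, v k⟫ ≤ ⟪v j, w⟫) (hlt : ⟪v l, v k⟫ < ⟪v l, w⟫) :
    ∃ e : E, (∀ j ≠ k, ⟪v j, e⟫ < 0) ∧ ⟪w, e⟫ < 0 ∧ 0 < ⟪v k, e⟫ ∧
      0 < ⟪v l, exchange (v k) w e⟫ := by
  set d := v k - w with hd
  have hd0 : 0 < ⟪d, d⟫ := real_inner_self_pos.2 fun h => by
    rw [sub_eq_zero.1 h] at hlt
    exact hlt.false
  have hvd : ⟪v k, d⟫ = ⟪d, d⟫ / 2 := by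
    rw [hd, real_inner_sub_sub_self, inner_sub_right, real_inner_self_eq_norm_sq,
      real_inner_self_eq_norm_sq, hw]
    ring
  have hwd : ⟪w, d⟫ = -(⟪d, d⟫ / 2) := by
    have : ⟪d, d⟫ = ⟪v k, d⟫ - ⟪w, d⟫ := inner_sub_left _ _ _
    linarith
  have hld : 0 < ⟪v l, exchange (v k) w d⟫ := by
    rw [exchange_sub hw, inner_neg_right, neg_pos, inner_sub_right]
    linarith
  -- The direction `d` satisfies every requirement up to equality in the first one.
  have hlim : ∀ u : E, Tendsto (fun η : ℝ => ⟪u, d + η • f⟫) (𝓝[>] 0) (𝓝 ⟪u, d⟫) := fun u => by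
    have hc : Continuous fun η : ℝ => ⟪u, d + η • f⟫ := by fun_prop
    simpa using (hc.tendsto 0).mono_left nhdsWithin_le_nhds
  obtain ⟨η, hη, hk, hw', hl⟩ := ((eventually_mem_nhdsWithin (a := (0 : ℝ)) (s := Set.Ioi 0)).and <|
    ((hlim (v k)).eventually_const_lt (show 0 < ⟪v k, d⟫ by linarith)).and <|
    ((hlim w).eventually_lt_const (show ⟪w, d⟫ < 0 by linarith)).and <|
    (hlim (exchange (v k) w (v l))).eventually_const_lt
      (by rwa [← inner_exchange])).exists
  refine ⟨d + η • f, fun j hj => ?_, hw', hk, by rwa [inner_exchange]⟩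
  rw [inner_add_right, real_inner_smul_right, inner_sub_right]
  linarith [hvw j hj, mul_neg_of_pos_of_neg hη (hf j)]

variable [DecidableEq ι]

theorem mem_innerBox_update {z : E} :
    z ∈ innerBox (update v k w) L ↔ ⟪w, z⟫ ∈ L k ∧ ∀ j ≠ k, ⟪v j, z⟫ ∈ L j :=
  forall_update_iff v fun i x => ⟪x, z⟫ ∈ L i

theorem mapsTo_exchange_innerBox_diff (hL : ∀ i, IsLowerSet (L i)) (hw : ‖v k‖ = ‖w‖)
    (hvw : ∀ j ≠ k, ⟪v j, v k⟫ ≤ ⟪v j, w⟫) :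
    Set.MapsTo (exchange (v k) w) (innerBox v L \ innerBox (update v k w) L)
      (innerBox (update v k w) L \ innerBox v L) := by
  rintro z ⟨hz, hz'⟩
  have hwz : ⟪w, z⟫ ∉ L k := fun h => hz' (mem_innerBox_update.2 ⟨h, fun j _ => hz j⟩)
  have hlt : ⟪v k - w, z⟫ ≤ 0 := by
    rw [inner_sub_left, sub_nonpos]
    by_contra! h
    exact hwz (hL k h.le (hz k))
  refine ⟨mem_innerBox_update.2 ⟨?_, fun j hj => ?_⟩, fun h => hwz ?_⟩
  · rw [inner_exchange, exchange_right hw]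
    exact hz k
  · refine hL j (inner_le_inner_exchange hlt ?_) (hz j)
    rw [inner_sub_right, sub_nonpos]
    exact hvw j hj
  · simpa only [inner_exchange, exchange_left hw] using h k

theorem innerBox_diff_mem_rayFilter [Finite ι] (hL : ∀ i, IsLowerSet (L i))
    (hne : ∀ i, (L i).Nonempty) (huniv : ∀ i, L i ≠ Set.univ) {e : E} {g : E ≃ₗᵢ[ℝ] E}
    (hj : ∀ j ≠ k, ⟪v j, e⟫ < 0) (hw : ⟪w, e⟫ < 0) (hk : 0 < ⟪v k, e⟫) (hl : 0 < ⟪v l, g e⟫) :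
    (innerBox (update v k w) L \ innerBox v L) \ g ⁻¹' innerBox v L ∈ rayFilter e := by
  have h_in : ∀ i u, ⟪u, e⟫ < 0 → ∀ᶠ z in rayFilter e, ⟪u, z⟫ ∈ L i := fun i u hu => by
    obtain ⟨b, hb⟩ := hne i
    filter_upwards [(tendsto_inner_rayFilter_atBot hu).eventually_le_atBot b] with z hz
      using hL i hz hb
  have h_out : ∀ i u, 0 < ⟪u, e⟫ → ∀ᶠ z in rayFilter e, ⟪u, z⟫ ∉ L i := fun i u hu => by
    obtain ⟨c, hc⟩ := (Set.ne_univ_iff_exists_notMem _).1 (huniv i)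
    filter_upwards [(tendsto_inner_rayFilter_atTop hu).eventually_ge_atTop c] with z hz
      using fun h => hc (hL i hz h)
  have hgl : ∀ z, ⟪v l, g z⟫ = ⟪g.symm (v l), z⟫ := fun z => by
    rw [LinearIsometryEquiv.inner_map_eq_flip, LinearIsometryEquiv.symm_symm]
  filter_upwards [h_in k w hw, eventually_all.2 fun j => eventually_imp_distrib_left.2
    fun h => h_in j (v j) (hj j h), h_out k (v k) hk, h_out l _ (hgl e ▸ hl)] with z h₁ h₂ h₃ h₄
  exact ⟨⟨mem_innerBox_update.2 ⟨h₁, h₂⟩, fun h => h₃ (h k)⟩, fun h => h₄ (hgl z ▸ h l)⟩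

variable [MeasurableSpace E] [BorelSpace E] {ν : Measure E}

theorem IsRotationInvariant.measure_innerBox_le_update [Countable ι] (hν : IsRotationInvariant ν)
    (hL : ∀ i, IsLowerSet (L i)) (hw : ‖v k‖ = ‖w‖) (hvw : ∀ j ≠ k, ⟪v j, v k⟫ ≤ ⟪v j, w⟫) :
    ν (innerBox v L) ≤ ν (innerBox (update v k w) L) := by
  set A := innerBox v L
  set B := innerBox (update v k w) L
  have hsub : A \ B ⊆ exchange (v k) w ⁻¹' (B \ A) := mapsTo_exchange_innerBox_diff hL hw hvw
  calc ν A = ν (A ∩ B) + ν (A \ B) :=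
        (measure_inter_add_sdiff A (measurableSet_innerBox_of_isLowerSet hL)).symm
    _ ≤ ν (B ∩ A) + ν (B \ A) := by
        rw [Set.inter_comm]
        exact add_le_add_right ((measure_mono hsub).trans (hν.measure_preimage _ _).le) _
    _ = ν B := measure_inter_add_sdiff B (measurableSet_innerBox_of_isLowerSet hL)

theorem IsRotationInvariant.measure_innerBox_lt_update [Finite ι] [IsFiniteMeasure ν]
    (hν : IsRotationInvariant ν) (hb : ¬ Bornology.IsBounded ν.support)
    (hL : ∀ i, IsLowerSet (L i)) (hne : ∀ i, (L i).Nonempty) (huniv : ∀ i, L i ≠ Set.univ)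
    (hf : ∀ i, ⟪v i, f⟫ < 0) (hw : ‖v k‖ = ‖w‖) (hvw : ∀ j ≠ k, ⟪v j, v k⟫ ≤ ⟪v j, w⟫)
    (hlt : ⟪v l, v k⟫ < ⟪v l, w⟫) :
    ν (innerBox v L) < ν (innerBox (update v k w) L) := by
  set A := innerBox v L
  set B := innerBox (update v k w) L
  have hA : MeasurableSet A := measurableSet_innerBox_of_isLowerSet hL
  have hB : MeasurableSet B := measurableSet_innerBox_of_isLowerSet hL
  obtain ⟨e, hj, hw', hk, hl⟩ := exists_exchange_direction hf hw hvw hlt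
  set g := exchange (v k) w
  have hsub : g ⁻¹' (A \ B) ⊆ B \ A := fun z hz => by
    simpa only [exchange_exchange, g] using mapsTo_exchange_innerBox_diff hL hw hvw hz
  have hpos : 0 < ν ((B \ A) \ g ⁻¹' (A \ B)) := by
    refine hν.measure_pos_of_mem_rayFilter hb (by rintro rfl; simp at hk)
      (mem_of_superset (innerBox_diff_mem_rayFilter hL hne huniv hj hw' hk hl) ?_)
    exact Set.sdiff_subset_sdiff_right (Set.preimage_mono Set.sdiff_subset)
  have hlt' : ν (A \ B) < ν (B \ A) := by
    rwa [measure_sdiff hsub (g.continuous.measurable (hA.diff hB)).nullMeasurableSet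
      (measure_ne_top _ _), tsub_pos_iff_lt, hν.measure_preimage] at hpos
  calc ν A = ν (A ∩ B) + ν (A \ B) := (measure_inter_add_sdiff A hB).symm
    _ < ν (B ∩ A) + ν (B \ A) := by
        rw [Set.inter_comm]
        exact ENNReal.add_lt_add_left (measure_ne_top _ _) hlt'
    _ = ν B := measure_inter_add_sdiff B hA

end Exchange

section Gram

variable {E : Type*} [NormedAddCommGroup E] [InnerProductSpace ℝ E] {ι : Type*}

theorem exists_linearIsometryEquiv_of_gram_eq [FiniteDimensional ℝ E] [Finite ι]
    {v w : ι → E} (h : gram ℝ v = gram ℝ w) : ∃ g : E ≃ₗᵢ[ℝ] E, ∀ i, g (v i) = w i := by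
  classical
  have := Fintype.ofFinite ι
  set A := Fintype.linearCombination ℝ v
  set B := Fintype.linearCombination ℝ w
  have hAB : ∀ c, ‖A c‖ = ‖B c‖ := fun c => by
    rw [← sq_eq_sq₀ (norm_nonneg _) (norm_nonneg _), ← real_inner_self_eq_norm_sq,
      ← real_inner_self_eq_norm_sq]
    simp only [A, B, Fintype.linearCombination_apply, ← star_dotProduct_gram_mulVec, h]
  obtain ⟨s, hs⟩ := A.rangeRestrict.exists_rightInverse_of_surjective A.range_rangeRestrict
  have hAs : ∀ x, A (s x) = x := fun x => congrArg Subtype.val (LinearMap.congr_fun hs x)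
  let f : LinearMap.range A →ₗᵢ[ℝ] E := ⟨B ∘ₗ s, fun x => by
    rw [LinearMap.comp_apply, ← hAB, hAs, Submodule.coe_norm]⟩
  have hf : ∀ c, f.extend (A c) = B c := fun c => by
    have hz : ‖B (s (A.rangeRestrict c) - c)‖ = 0 := by
      rw [← hAB, map_sub, hAs]
      simp
    rw [norm_eq_zero, map_sub, sub_eq_zero] at hz
    exact (f.extend_apply (A.rangeRestrict c)).trans hz
  refine ⟨f.extend.toLinearIsometryEquiv rfl, fun i => ?_⟩
  simpa [A, B, Fintype.linearCombination_apply_single] using hf (Pi.single i 1)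

variable [Fintype ι] [DecidableEq ι]

open scoped MatrixOrder in
/-- A family of vectors with Gram matrix `S`, when `S` is positive semidefinite: the rows of the
square root of `S`. -/
noncomputable def gramVectors (S : Matrix ι ι ℝ) (i : ι) : EuclideanSpace ℝ ι :=
  WithLp.toLp 2 (CFC.sqrt S i)

variable {S : Matrix ι ι ℝ}

open scoped MatrixOrder in
theorem gram_gramVectors (hS : S.PosSemidef) : gram ℝ (gramVectors S) = S := by
  have hsymm : (CFC.sqrt S)ᵀ = CFC.sqrt S := (nonneg_iff_posSemidef.1 (CFC.sqrt_nonneg S)).1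
  conv_rhs => rw [← CFC.sqrt_mul_sqrt_self S hS.nonneg]
  ext i j
  rw [gram_apply, gramVectors, gramVectors, EuclideanSpace.inner_toLp_toLp, star_trivial,
    dotProduct_comm, mul_apply']
  exact congrArg (CFC.sqrt S i ⬝ᵥ ·) (congrFun hsymm j).symm

theorem inner_gramVectors (hS : S.PosSemidef) (i j : ι) :
    ⟪gramVectors S i, gramVectors S j⟫ = S i j := by
  rw [← gram_apply, gram_gramVectors hS]

theorem exists_inner_gramVectors_eq (hS : S.PosDef) (c : ι → ℝ) :
    ∃ x, ∀ i, ⟪gramVectors S i, x⟫ = c i := by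
  refine ⟨∑ j, (S⁻¹ *ᵥ c) j • gramVectors S j, fun i => ?_⟩
  simp only [inner_sum, real_inner_smul_right, inner_gramVectors hS.posSemidef]
  have h : S *ᵥ S⁻¹ *ᵥ c = c := by
    rw [mulVec_mulVec, mul_nonsing_inv _ ((isUnit_iff_isUnit_det S).1 hS.isUnit), one_mulVec]
  simpa only [mulVec, dotProduct, mul_comm] using congrFun h i

open scoped MatrixOrder Matrix.Norms.L2Operator in
theorem tendsto_gramVectors {α : Type*} {l : Filter α} {F : α → Matrix ι ι ℝ}
    (hF : ∀ a, (F a).PosSemidef) (hS : S.PosSemidef) (h : Tendsto F l (𝓝 S)) (i : ι) :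
    Tendsto (fun a => gramVectors (F a) i) l (𝓝 (gramVectors S i)) := by
  have hsqrt : Tendsto (fun a => CFC.sqrt (F a)) l (𝓝 (CFC.sqrt S)) :=
    (CFC.continuousOn_sqrt S hS.nonneg).tendsto.comp
      (tendsto_nhdsWithin_iff.2 ⟨h, .of_forall fun a => (hF a).nonneg⟩)
  exact ((PiLp.continuous_toLp 2 _).tendsto _).comp ((continuous_apply i).tendsto _ |>.comp hsqrt)

end Gram

section RowColPart

variable {ι : Type*} {S D : Matrix ι ι ℝ}

/-- The symmetric matrix `T` arises from the symmetric matrix `S` by increasing some off-diagonal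
entries in the row and the column `k`; by symmetry, only the column is compared. -/
structure IsRowIncrease (k : ι) (S T : Matrix ι ι ℝ) : Prop where
  eq_of_ne : ∀ i ≠ k, ∀ j ≠ k, S i j = T i j
  diag_eq : S k k = T k k
  le : ∀ j ≠ k, S j k ≤ T j k

variable [DecidableEq ι]

/-- The matrix with the entries of `D` in the rows and columns with indices in `U`, and zeros
elsewhere. -/
def rowColPart (D : Matrix ι ι ℝ) (U : Finset ι) : Matrix ι ι ℝ :=
  of fun i j => if i ∈ U ∨ j ∈ U then D i j else 0

theorem rowColPart_apply (U : Finset ι) (i j : ι) :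
    rowColPart D U i j = if i ∈ U ∨ j ∈ U then D i j else 0 := rfl

theorem rowColPart_empty : rowColPart D ∅ = 0 := by
  ext i j
  simp [rowColPart_apply]

theorem rowColPart_univ [Fintype ι] : rowColPart D Finset.univ = D := by
  ext i j
  simp [rowColPart_apply]

theorem rowColPart_smul (c : ℝ) (U : Finset ι) : rowColPart (c • D) U = c • rowColPart D U := by
  ext i j
  simp [rowColPart_apply]

theorem isHermitian_rowColPart (hD : D.IsHermitian) (U : Finset ι) :
    (rowColPart D U).IsHermitian := by
  ext i j
  have h : D j i = D i j := hD.apply i j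
  simp [rowColPart_apply, h, or_comm]

theorem isRowIncrease_add_rowColPart (hdiag : ∀ i, D i i = 0) (hnn : ∀ i j, 0 ≤ D i j) (k : ι)
    (U : Finset ι) : IsRowIncrease k (S + rowColPart D U) (S + rowColPart D (insert k U)) where
  eq_of_ne i hi j hj := by simp [rowColPart_apply, hi, hj]
  diag_eq := by simp [rowColPart_apply, hdiag]
  le j hj := by
    simp only [Matrix.add_apply, rowColPart_apply, Finset.mem_insert, hj, false_or, true_or,
      or_true, if_true]
    gcongr
    split_ifs
    exacts [le_rfl, hnn j k]

end RowColPart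

section RowSteps

variable {ι : Type*} [Fintype ι] [DecidableEq ι] {S T D : Matrix ι ι ℝ} {k : ι}
  {ν : Measure (EuclideanSpace ℝ ι)} {L : ι → Set ℝ}

/-- The probability that the random vector with coordinates `⟪gramVectors S i, z⟫`, where `z` has
the law `ν`, falls into the box `∏ i, L i`. For spherically symmetric `ν` this vector has the
centred elliptical law with dispersion matrix `S`. -/
noncomputable def boxProb (ν : Measure (EuclideanSpace ℝ ι)) (S : Matrix ι ι ℝ)
    (L : ι → Set ℝ) : ENNReal :=
  ν (innerBox (gramVectors S) L)

theorem IsRotationInvariant.measure_innerBox_eq_boxProb (hν : IsRotationInvariant ν)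
    (v : ι → EuclideanSpace ℝ ι) : ν (innerBox v L) = boxProb ν (gram ℝ v) L := by
  obtain ⟨g, hg⟩ := exists_linearIsometryEquiv_of_gram_eq
    (gram_gramVectors (posSemidef_gram ℝ v)).symm
  rw [boxProb, ← funext hg, ← preimage_innerBox g, hν.measure_preimage]

theorem IsRowIncrease.exists_gram_update_eq (h : IsRowIncrease k S T) (hS : S.PosSemidef)
    (hT : T.PosSemidef) : ∃ w, gram ℝ (update (gramVectors S) k w) = T := by
  have hgram : gram ℝ (fun i : {i // i ≠ k} => gramVectors T i) =
      gram ℝ fun i : {i // i ≠ k} => gramVectors S i := by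
    ext i j
    rw [gram_apply, gram_apply, inner_gramVectors hS, inner_gramVectors hT,
      h.eq_of_ne i i.2 j j.2]
  obtain ⟨g, hg⟩ := exists_linearIsometryEquiv_of_gram_eq hgram
  have hupdate : update (gramVectors S) k (g (gramVectors T k)) = fun i => g (gramVectors T i) := by
    rw [update_eq_iff]
    exact ⟨rfl, fun i hi => (hg ⟨i, hi⟩).symm⟩
  refine ⟨g (gramVectors T k), ?_⟩
  ext i j
  rw [hupdate, gram_apply, g.inner_map_map, inner_gramVectors hT]

theorem inner_left_of_gram_update_eq {v : ι → EuclideanSpace ℝ ι} {w : EuclideanSpace ℝ ι}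
    (h : gram ℝ (update v k w) = T) {j : ι} (hj : j ≠ k) : ⟪v j, w⟫ = T j k := by
  rw [← h, gram_apply, update_of_ne hj, update_self]

theorem norm_eq_of_gram_update_eq {v : ι → EuclideanSpace ℝ ι} {w : EuclideanSpace ℝ ι}
    (h : gram ℝ (update v k w) = T) (hk : ⟪v k, v k⟫ = T k k) : ‖v k‖ = ‖w‖ := by
  have hw : ⟪w, w⟫ = T k k := by rw [← h, gram_apply, update_self]
  rw [← sq_eq_sq₀ (norm_nonneg _) (norm_nonneg _), ← real_inner_self_eq_norm_sq,
    ← real_inner_self_eq_norm_sq, hk, hw]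

theorem IsRowIncrease.boxProb_le (h : IsRowIncrease k S T) (hS : S.PosSemidef)
    (hT : T.PosSemidef) (hν : IsRotationInvariant ν) (hL : ∀ i, IsLowerSet (L i)) :
    boxProb ν S L ≤ boxProb ν T L := by
  obtain ⟨w, hw⟩ := h.exists_gram_update_eq hS hT
  rw [← hw, ← hν.measure_innerBox_eq_boxProb]
  refine hν.measure_innerBox_le_update hL
    (norm_eq_of_gram_update_eq hw (by rw [inner_gramVectors hS, h.diag_eq])) fun j hj => ?_
  rw [inner_gramVectors hS, inner_left_of_gram_update_eq hw hj]
  exact h.le j hj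

theorem IsRowIncrease.boxProb_lt (h : IsRowIncrease k S T) (hS : S.PosDef) (hT : T.PosSemidef)
    {l : ι} (hlt : S l k < T l k) [IsFiniteMeasure ν] (hν : IsRotationInvariant ν)
    (hb : ¬ Bornology.IsBounded ν.support) (hL : ∀ i, IsLowerSet (L i))
    (hne : ∀ i, (L i).Nonempty) (huniv : ∀ i, L i ≠ Set.univ) :
    boxProb ν S L < boxProb ν T L := by
  have hl : l ≠ k := by
    rintro rfl
    exact hlt.ne h.diag_eq
  obtain ⟨w, hw⟩ := h.exists_gram_update_eq hS.posSemidef hT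
  obtain ⟨f, hf⟩ := exists_inner_gramVectors_eq hS fun _ => -1
  rw [← hw, ← hν.measure_innerBox_eq_boxProb]
  refine hν.measure_innerBox_lt_update (f := f) (l := l) hb hL hne huniv
    (fun i => by rw [hf i]; norm_num)
    (norm_eq_of_gram_update_eq hw (by rw [inner_gramVectors hS.posSemidef, h.diag_eq]))
    (fun j hj => ?_) ?_
  · rw [inner_gramVectors hS.posSemidef, inner_left_of_gram_update_eq hw hj]
    exact h.le j hj
  · rwa [inner_gramVectors hS.posSemidef, inner_left_of_gram_update_eq hw hl]

theorem boxProb_le_add_of_forall_rowColPart (hν : IsRotationInvariant ν)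
    (hL : ∀ i, IsLowerSet (L i)) (hpsd : ∀ U, (S + rowColPart D U).PosSemidef)
    (hdiag : ∀ i, D i i = 0) (hnn : ∀ i j, 0 ≤ D i j) :
    boxProb ν S L ≤ boxProb ν (S + D) L := by
  have h (U : Finset ι) : boxProb ν S L ≤ boxProb ν (S + rowColPart D U) L := by
    induction U using Finset.induction_on with
    | empty => rw [rowColPart_empty, add_zero]
    | insert k U _ ih =>
      have hrow := isRowIncrease_add_rowColPart (S := S) hdiag hnn k U
      exact ih.trans (hrow.boxProb_le (hpsd _) (hpsd _) hν hL)
  simpa only [rowColPart_univ] using h Finset.univ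

end RowSteps

section Subdivision

variable {ι : Type*} {S D G M : Matrix ι ι ℝ}

theorem eventually_posDef_add_smul [Finite ι] (hG : G.PosDef) (hM : M.IsHermitian) :
    ∀ᶠ ε : ℝ in 𝓝 0, (G + ε • M).PosDef := by
  have := Fintype.ofFinite ι
  have hcont : Continuous fun p : ℝ × (ι → ℝ) => p.2 ⬝ᵥ ((G + p.1 • M) *ᵥ p.2) := by
    simp only [dotProduct, mulVec]
    fun_prop
  have hsphere : ∀ᶠ ε : ℝ in 𝓝 0, ∀ x ∈ Metric.sphere (0 : ι → ℝ) 1,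
      0 < x ⬝ᵥ ((G + ε • M) *ᵥ x) := by
    refine (isCompact_sphere 0 1).eventually_forall_of_forall_eventually fun x hx => ?_
    refine (hcont.tendsto (0, x)).eventually_const_lt ?_
    simpa using hG.dotProduct_mulVec_pos (ne_zero_of_mem_unit_sphere ⟨x, hx⟩)
  filter_upwards [hsphere] with ε hε
  refine .of_dotProduct_mulVec_pos (hG.1.add (hM.smul (IsSelfAdjoint.all ε))) fun x hx => ?_
  have hx' : 0 < ‖x‖⁻¹ := inv_pos.2 (norm_pos_iff.2 hx)
  have h := hε (‖x‖⁻¹ • x) (by simp [norm_smul, hx])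
  rw [mulVec_smul, dotProduct_smul, smul_dotProduct, smul_eq_mul, smul_eq_mul] at h
  exact (mul_pos_iff_of_pos_left hx').1 ((mul_pos_iff_of_pos_left hx').1 h)

variable [Fintype ι] [DecidableEq ι] {ν : Measure (EuclideanSpace ℝ ι)} {L : ι → Set ℝ}

theorem boxProb_add_posDef_le (hν : IsRotationInvariant ν) (hL : ∀ i, IsLowerSet (L i))
    (hG : G.PosDef) (hS : S.PosSemidef) (hSD : (S + D).PosSemidef) (hdiag : ∀ i, D i i = 0)
    (hnn : ∀ i j, 0 ≤ D i j) : boxProb ν (S + G) L ≤ boxProb ν (S + D + G) L := by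
  have hD : D.IsHermitian := by simpa using hSD.1.sub hS.1
  have hev : ∀ᶠ ε : ℝ in 𝓝 0, ∀ U, (G + ε • rowColPart D U).PosDef :=
    eventually_all.2 fun U => eventually_posDef_add_smul hG (isHermitian_rowColPart hD U)
  obtain ⟨N, hN, hN0⟩ := ((tendsto_inv_atTop_nhds_zero_nat (𝕜 := ℝ)).eventually hev |>.and
    (eventually_gt_atTop 0)).exists
  have hN0' : (0 : ℝ) < N := by exact_mod_cast hN0
  have hpsd : ∀ m < N, (S + (m * (N : ℝ)⁻¹) • D).PosSemidef := fun m hm => by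
    have hm1 : m * (N : ℝ)⁻¹ ≤ 1 := by
      rw [← div_eq_mul_inv, div_le_one hN0']
      exact_mod_cast hm.le
    convert (hS.smul (sub_nonneg.2 hm1)).add (hSD.smul (a := m * (N : ℝ)⁻¹) (by positivity)) using 1
    module
  have hsteps : ∀ m ≤ N, boxProb ν (S + G) L ≤ boxProb ν (S + (m * (N : ℝ)⁻¹) • D + G) L := by
    intro m
    induction m with
    | zero => simp
    | succ m ih =>
      intro hm
      have h := boxProb_le_add_of_forall_rowColPart (S := S + (m * (N : ℝ)⁻¹) • D + G)
        (D := (N : ℝ)⁻¹ • D) hν hL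
        (fun U => by
          rw [rowColPart_smul, add_assoc]
          exact (hpsd m hm).add (hN U).posSemidef)
        (fun i => by simp [hdiag]) fun i j => mul_nonneg (by positivity) (hnn i j)
      have hnext : S + (m * (N : ℝ)⁻¹) • D + G + (N : ℝ)⁻¹ • D =
          S + ((m + 1 : ℕ) * (N : ℝ)⁻¹) • D + G := by
        push_cast
        module
      exact (ih (by omega)).trans (hnext ▸ h)
  simpa [hN0.ne'] using hsteps N le_rfl

end Subdivision

theorem measure_le_of_subset_liminf_of_limsup_subset {α : Type*} [MeasurableSpace α]
    {μ : Measure α} [IsFiniteMeasure μ] {A B : ℕ → Set α} {s t : Set α}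
    (hB : ∀ m, MeasurableSet (B m)) (hAB : ∀ m, μ (A m) ≤ μ (B m)) (hs : s ⊆ liminf A atTop)
    (ht : limsup B atTop ⊆ t) : μ s ≤ μ t := by
  have hlim_inf : Tendsto (fun m => μ (⋂ k ≥ m, A k)) atTop (𝓝 (μ (liminf A atTop))) := by
    rw [liminf_eq_iSup_iInf_of_nat]
    exact tendsto_measure_iUnion_atTop fun m m' h =>
      Set.biInter_subset_biInter_left fun k hk => h.trans hk
  have hlim_sup : Tendsto (fun m => μ (⋃ k ≥ m, B k)) atTop (𝓝 (μ (limsup B atTop))) := by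
    rw [limsup_eq_iInf_iSup_of_nat]
    exact tendsto_measure_iInter_atTop
      (fun m => (MeasurableSet.biUnion (Set.to_countable _) fun k _ => hB k).nullMeasurableSet)
      (fun m m' h => Set.biUnion_subset_biUnion_left fun k hk => h.trans hk)
      ⟨0, measure_ne_top _ _⟩
  calc μ s ≤ μ (liminf A atTop) := measure_mono hs
    _ ≤ μ (limsup B atTop) := le_of_tendsto_of_tendsto' hlim_inf hlim_sup fun m =>
        (measure_mono (Set.biInter_subset_of_mem (Set.mem_Ici.2 le_rfl))).trans <|
          (hAB m).trans (measure_mono (Set.subset_biUnion_of_mem (u := B) (Set.mem_Ici.2 le_rfl)))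
    _ ≤ μ t := measure_mono ht

section Comparison

variable {ι : Type*} [Fintype ι] [DecidableEq ι] {S T : Matrix ι ι ℝ}
  {ν : Measure (EuclideanSpace ℝ ι)} [IsFiniteMeasure ν] {L : ι → Set ℝ}

theorem tendsto_inner_gramVectors_add_smul_one (hS : S.PosSemidef) (i : ι)
    (z : EuclideanSpace ℝ ι) :
    Tendsto (fun m : ℕ => ⟪gramVectors (S + (1 / ((m : ℝ) + 1)) • 1) i, z⟫) atTop
      (𝓝 ⟪gramVectors S i, z⟫) := by
  refine (tendsto_gramVectors (fun m => ?_) hS ?_ i).inner tendsto_const_nhds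
  · exact hS.add (PosSemidef.one.smul (by positivity))
  · simpa using (tendsto_one_div_add_atTop_nhds_zero_nat (𝕜 := ℝ)).smul_const
      (1 : Matrix ι ι ℝ) |>.const_add S

theorem boxProb_Iic_le_of_lt (hν : IsRotationInvariant ν) (hS : S.PosSemidef) (hT : T.PosSemidef)
    (hdiag : ∀ i, S i i = T i i) (hle : ∀ i j, S i j ≤ T i j) {a b : ι → ℝ}
    (hab : ∀ i, a i < b i) :
    boxProb ν S (fun i => Set.Iic (a i)) ≤ boxProb ν T (fun i => Set.Iic (b i)) := by
  have hreg : ∀ m : ℕ, boxProb ν (S + (1 / ((m : ℝ) + 1)) • 1) (fun i => Set.Iic (b i)) ≤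
      boxProb ν (T + (1 / ((m : ℝ) + 1)) • 1) (fun i => Set.Iic (b i)) := fun m => by
    have h := boxProb_add_posDef_le (S := S) (D := T - S) hν (fun i => isLowerSet_Iic (b i))
      (PosDef.one.smul (by positivity : 0 < 1 / ((m : ℝ) + 1))) hS (by rwa [add_sub_cancel])
      (fun i => sub_eq_zero.2 (hdiag i).symm) fun i j => sub_nonneg.2 (hle i j)
    rwa [add_sub_cancel] at h
  refine measure_le_of_subset_liminf_of_limsup_subset
    (fun m => measurableSet_innerBox fun i => measurableSet_Iic) hreg
    (fun z hz => ?_) fun z hz i => ?_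
  · rw [mem_liminf_iff_eventually_mem]
    refine eventually_all.2 fun i => ?_
    filter_upwards [(tendsto_inner_gramVectors_add_smul_one hS i z).eventually_lt_const
      ((hz i).trans_lt (hab i))] with m hm using hm.le
  · rw [mem_limsup_iff_frequently_mem] at hz
    exact le_of_tendsto_of_frequently (tendsto_inner_gramVectors_add_smul_one hT i z)
      (hz.mono fun m hm => hm i)

theorem boxProb_Iic_le (hν : IsRotationInvariant ν) (hS : S.PosSemidef) (hT : T.PosSemidef)
    (hdiag : ∀ i, S i i = T i i) (hle : ∀ i j, S i j ≤ T i j) (a : ι → ℝ) :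
    boxProb ν S (fun i => Set.Iic (a i)) ≤ boxProb ν T (fun i => Set.Iic (a i)) := by
  refine measure_le_of_subset_liminf_of_limsup_subset
    (fun m => measurableSet_innerBox fun i => measurableSet_Iic)
    (fun m => boxProb_Iic_le_of_lt hν hS hT hdiag hle (b := fun i => a i + 1 / ((m : ℝ) + 1))
      fun i => lt_add_of_pos_right _ (by positivity))
    (by rw [liminf_const]) fun z hz i => ?_
  rw [mem_limsup_iff_frequently_mem] at hz
  have hlim : Tendsto (fun m : ℕ => a i + 1 / ((m : ℝ) + 1)) atTop (𝓝 (a i)) := by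
    simpa using tendsto_one_div_add_atTop_nhds_zero_nat.const_add (a i)
  exact ge_of_tendsto_of_frequently hlim (hz.mono fun m hm => hm i)

theorem boxProb_le (hν : IsRotationInvariant ν) (hL : ∀ i, IsLowerSet (L i)) (hS : S.PosSemidef)
    (hT : T.PosSemidef) (hdiag : ∀ i, S i i = T i i) (hle : ∀ i j, S i j ≤ T i j) :
    boxProb ν S L ≤ boxProb ν T L := by
  by_cases! hne : ∃ i, L i = ∅
  · obtain ⟨i, hi⟩ := hne
    have hempty : innerBox (gramVectors S) L = ∅ := Set.eq_empty_of_forall_notMem fun z hz => by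
      simpa [hi] using hz i
    rw [boxProb, hempty, measure_empty]
    exact zero_le
  have hexhaust (i : ι) : ∃ c : ℕ → L i, Tendsto c atTop atTop := by
    have := (hne i).to_subtype
    have := (hL i).ordConnected
    exact exists_seq_tendsto _
  choose c hc using hexhaust
  refine measure_le_of_subset_liminf_of_limsup_subset
    (fun m => measurableSet_innerBox fun i => measurableSet_Iic)
    (fun m => boxProb_Iic_le hν hS hT hdiag hle fun i => c i m) (fun z hz => ?_) fun z hz i => ?_
  · rw [mem_liminf_iff_eventually_mem]
    exact eventually_all.2 fun i => (hc i).eventually_ge_atTop ⟨_, hz i⟩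
  · rw [mem_limsup_iff_frequently_mem] at hz
    obtain ⟨m, hm⟩ := hz.exists
    exact hL i (hm i) (c i m).2

theorem boxProb_lt (hν : IsRotationInvariant ν) (hb : ¬ Bornology.IsBounded ν.support)
    (hL : ∀ i, IsLowerSet (L i)) (hne : ∀ i, (L i).Nonempty) (huniv : ∀ i, L i ≠ Set.univ)
    (hS : S.PosSemidef) (hT : T.PosSemidef) (hST : (S + T).PosDef) (hdiag : ∀ i, S i i = T i i)
    (hle : ∀ i j, S i j ≤ T i j) {l k : ι} (hlt : S l k < T l k) :
    boxProb ν S L < boxProb ν T L := by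
  set D := T - S
  have hDdiag : ∀ i, D i i = 0 := fun i => sub_eq_zero.2 (hdiag i).symm
  have hDnn : ∀ i j, 0 ≤ D i j := fun i j => sub_nonneg.2 (hle i j)
  set M := (1 / 2 : ℝ) • (S + T)
  have hM : M.PosDef := hST.smul (by norm_num)
  have hM_apply : ∀ i j, M i j = (S i j + T i j) / 2 := fun i j => by
    simp only [M, Matrix.smul_apply, Matrix.add_apply, smul_eq_mul]
    ring
  obtain ⟨ε, hε0, hε, hM'⟩ := ((eventually_mem_nhdsWithin (a := (0 : ℝ)) (s := Set.Ioi 0)).and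
    (((eventually_le_nhds one_half_pos).and (eventually_posDef_add_smul hM
      (isHermitian_rowColPart (hT.1.sub hS.1) {k}))).filter_mono nhdsWithin_le_nhds)).exists
  rw [← rowColPart_smul] at hM'
  have hrow : IsRowIncrease k M (M + rowColPart (ε • D) {k}) := by
    simpa only [rowColPart_empty, add_zero, insert_empty_eq] using
      isRowIncrease_add_rowColPart (S := M) (D := ε • D) (fun i => by simp [hDdiag])
        (fun i j => mul_nonneg hε0.le (hDnn i j)) k ∅
  have hM'_apply : ∀ i j, (M + rowColPart (ε • D) {k}) i j =
      M i j + if i = k ∨ j = k then ε * D i j else 0 := fun i j => by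
    simp [rowColPart_apply]
  calc boxProb ν S L ≤ boxProb ν M L := by
        refine boxProb_le hν hL hS hM.posSemidef (fun i => ?_) fun i j => ?_
        · linarith [hdiag i, hM_apply i i]
        · linarith [hle i j, hM_apply i j]
    _ < boxProb ν (M + rowColPart (ε • D) {k}) L := by
        refine hrow.boxProb_lt hM hM'.posSemidef (l := l) ?_ hν hb hL hne huniv
        rw [hM'_apply, if_pos (.inr rfl)]
        exact lt_add_of_pos_right _ (mul_pos hε0 (sub_pos.2 hlt))
    _ ≤ boxProb ν T L := by
        refine boxProb_le hν hL hM'.posSemidef hT (fun i => ?_) fun i j => ?_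
        · rw [hM'_apply, hM_apply, hDdiag, hdiag]
          simp
        · have hDij : D i j = T i j - S i j := rfl
          rw [hM'_apply, hM_apply]
          split_ifs <;> nlinarith [hle i j]

end Comparison

theorem eq_of_exp_mul_eq_exp_mul {f g : ℝ → ℝ} {p q : ℝ} (hf : ContinuousAt f 0) (hf0 : f 0 ≠ 0)
    (h : ∀ t : ℝ, Complex.exp ((t * p : ℝ) * Complex.I) * (f t : ℂ) =
      Complex.exp ((t * q : ℝ) * Complex.I) * (g t : ℂ)) : p = q := by
  by_contra hne
  have hsin (t : ℝ) : Real.sin (t * (p - q)) * f t = 0 := by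
    have hrot : Complex.exp ((t * (p - q) : ℝ) * Complex.I) * (f t : ℂ) = g t := by
      have hexp : Complex.exp ((t * (p - q) : ℝ) * Complex.I) =
          Complex.exp ((t * p : ℝ) * Complex.I) / Complex.exp ((t * q : ℝ) * Complex.I) := by
        rw [← Complex.exp_sub]
        push_cast
        ring_nf
      rw [hexp, div_mul_eq_mul_div, h, mul_div_cancel_left₀ _ (Complex.exp_ne_zero _)]
    have him := congrArg Complex.im hrot
    rwa [Complex.im_mul_ofReal, Complex.exp_ofReal_mul_I_im, Complex.ofReal_im] at him
  have hsmall : ∀ᶠ t : ℝ in 𝓝 0, |t * (p - q)| < Real.pi := by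
    have hc : Continuous fun t : ℝ => |t * (p - q)| := by fun_prop
    exact hc.continuousAt.eventually_lt_const (by simpa using Real.pi_pos)
  obtain ⟨t, ht0, hft, htpi⟩ := ((eventually_mem_nhdsWithin (a := (0 : ℝ)) (s := Set.Ioi 0)).and
    (((hf.eventually_ne hf0).and hsmall).filter_mono nhdsWithin_le_nhds)).exists
  have hs : Real.sin (t * (p - q)) = 0 := (mul_eq_zero.1 (hsin t)).resolve_right hft
  rw [abs_lt] at htpi
  exact mul_ne_zero (ne_of_gt ht0) (sub_ne_zero.2 hne)
    ((Real.sin_eq_zero_iff_of_lt_of_lt htpi.1 htpi.2).1 hs)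

theorem eq_apply_zero_of_apply_mul_eq {f : ℝ → ℝ} (hf : ContinuousWithinAt f (Set.Ici 0) 0)
    {a b : ℝ} (ha : 0 ≤ a) (hab : a < b) (h : ∀ u, 0 ≤ u → f (a * u) = f (b * u)) {u : ℝ}
    (hu : 0 ≤ u) : f u = f 0 := by
  have hb : 0 < b := ha.trans_lt hab
  have hr : 0 ≤ a / b := by positivity
  have hpow (k : ℕ) : f ((a / b) ^ k * u) = f u := by
    induction k with
    | zero => simp
    | succ k ih =>
      calc f ((a / b) ^ (k + 1) * u) = f (a * ((a / b) ^ k * u / b)) := by ring_nf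
        _ = f (b * ((a / b) ^ k * u / b)) := h _ (by positivity)
        _ = f u := by rw [mul_div_cancel₀ _ hb.ne', ih]
  have hlim : Tendsto (fun k : ℕ => (a / b) ^ k * u) atTop (𝓝[≥] 0) := by
    refine tendsto_nhdsWithin_iff.2 ⟨?_, .of_forall fun k => Set.mem_Ici.2 (by positivity)⟩
    simpa using (tendsto_pow_atTop_nhds_zero_of_lt_one hr ((div_lt_one hb).2 hab)).mul_const u
  exact tendsto_nhds_unique (tendsto_const_nhds.congr fun k => (hpow k).symm) (hf.tendsto.comp hlim)

section Generator

variable {n : ℕ} {φ : ℝ → ℝ}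

theorem IsCharacteristicGenerator.apply_zero (hφ : IsCharacteristicGenerator n φ) : φ 0 = 1 := by
  obtain ⟨ν, _, hν⟩ := hφ
  have h := hν 0
  rw [charFun_zero, probReal_univ, norm_zero, zero_pow two_ne_zero] at h
  exact_mod_cast h.symm

theorem IsCharacteristicGenerator.continuousOn (hφ : IsCharacteristicGenerator n φ) (hn : 0 < n) :
    ContinuousOn φ (Set.Ici 0) := by
  obtain ⟨ν, _, hν⟩ := hφ
  set e : EuclideanSpace ℝ (Fin n) := EuclideanSpace.single ⟨0, hn⟩ 1
  have hcont : Continuous fun u : ℝ => (charFun ν (√u • e)).re := by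
    have : Continuous (charFun ν) := by fun_prop
    fun_prop
  refine hcont.continuousOn.congr fun u hu => ?_
  have he : ‖√u • e‖ ^ 2 = u := by simp [e, norm_smul, Real.sq_sqrt (Set.mem_Ici.1 hu)]
  simp only [hν, he, Complex.ofReal_re]

theorem charFun_map_inner_eq {E : Type*} [NormedAddCommGroup E] [InnerProductSpace ℝ E]
    [MeasurableSpace E] [OpensMeasurableSpace E] {ν : Measure E} {ι : Type*} [Fintype ι]
    (hν : ∀ t, charFun ν t = (φ (‖t‖ ^ 2) : ℂ)) (v : ι → E) (t : EuclideanSpace ℝ ι) :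
    charFun (ν.map fun z => WithLp.toLp 2 fun i => ⟪v i, z⟫) t =
      (φ (t.ofLp ⬝ᵥ (gram ℝ v *ᵥ t.ofLp)) : ℂ) := by
  have hinner (z : E) (s : EuclideanSpace ℝ ι) :
      ⟪WithLp.toLp 2 fun i => ⟪v i, z⟫, s⟫ = ⟪z, ∑ i, s i • v i⟫ := by
    simp [PiLp.inner_apply, inner_sum, real_inner_smul_right, real_inner_comm z]
  rw [charFun_map_of_inner_eq (f' := fun s => ∑ i, s i • v i) (by fun_prop) hinner, hν,
    ← real_inner_self_eq_norm_sq, ← star_dotProduct_gram_mulVec, star_trivial]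

end Generator

section Elliptical

variable {Ω Ω' : Type*} [MeasurableSpace Ω] [MeasurableSpace Ω'] {P : Measure Ω} {Q : Measure Ω'}
  {n : ℕ} {X : Ω → EuclideanSpace ℝ (Fin n)} {Y : Ω' → EuclideanSpace ℝ (Fin n)}
  {m m' : EuclideanSpace ℝ (Fin n)} {S T : Matrix (Fin n) (Fin n) ℝ} {φ : ℝ → ℝ}
  {ν : Measure (EuclideanSpace ℝ (Fin n))} {L : Fin n → Set ℝ}

theorem IsElliptical.dispersion_nonneg (hX : IsElliptical X P m S φ)
    (t : EuclideanSpace ℝ (Fin n)) : 0 ≤ t.ofLp ⬝ᵥ (S *ᵥ t.ofLp) := by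
  simpa using hX.posSemidef.dotProduct_mulVec_nonneg t.ofLp

theorem IsElliptical.neg (hX : IsElliptical X P m S φ) :
    IsElliptical (fun ω => -X ω) P (-m) S φ where
  aemeasurable := hX.aemeasurable.neg
  generator := hX.generator
  posSemidef := hX.posSemidef
  charFun_eq t := by
    have hmap : P.map (fun ω => -X ω) = (P.map X).map fun x => -x :=
      (AEMeasurable.map_map_of_aemeasurable (by fun_prop) hX.aemeasurable).symm
    rw [hmap, charFun_map_of_inner_eq (f' := fun t => -t) (by fun_prop)
      (fun z s => by rw [inner_neg_left, inner_neg_right]), hX.charFun_eq]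
    simp [mulVec_neg]

theorem IsElliptical.dispersion_congr (hX : IsElliptical X P m S φ) (hφ : ∀ u, 0 ≤ u → φ u = 1)
    (hT : T.PosSemidef) : IsElliptical X P m T φ where
  aemeasurable := hX.aemeasurable
  generator := hX.generator
  posSemidef := hT
  charFun_eq t := by
    rw [hX.charFun_eq, hφ _ (hX.dispersion_nonneg t),
      hφ _ (by simpa using hT.dotProduct_mulVec_nonneg t.ofLp)]

theorem inner_eq_dotProduct (x y : EuclideanSpace ℝ (Fin n)) : ⟪x, y⟫ = y.ofLp ⬝ᵥ x.ofLp := by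
  simp [EuclideanSpace.inner_eq_star_dotProduct]

theorem IsElliptical.charFun_map_apply (hX : IsElliptical X P m S φ) (i : Fin n) (t : ℝ) :
    charFun (P.map fun ω => X ω i) t =
      Complex.exp ((t * m i : ℝ) * Complex.I) * (φ (S i i * t ^ 2) : ℂ) := by
  have hmap : P.map (fun ω => X ω i) = (P.map X).map fun x => x i :=
    (AEMeasurable.map_map_of_aemeasurable (g := fun x : EuclideanSpace ℝ (Fin n) => x i)
      (by fun_prop) hX.aemeasurable).symm
  rw [hmap, charFun_map_of_inner_eq (f' := EuclideanSpace.single i) (by fun_prop)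
    (fun z s => by simp [EuclideanSpace.inner_single_right]), hX.charFun_eq,
    mul_comm Complex.I]
  congr 3
  · simp
  · simp
    ring

theorem IsElliptical.location_eq_of_map_apply_eq (hX : IsElliptical X P m S φ)
    (hY : IsElliptical Y Q m' T φ)
    (h : ∀ i, P.map (fun ω => X ω i) = Q.map fun ω => Y ω i) : m = m' := by
  ext i
  have hcont : ContinuousAt (fun t => φ (S i i * t ^ 2)) 0 := by
    refine ContinuousOn.comp_continuous (hX.generator.continuousOn i.pos) (by fun_prop)
      (fun t => mul_nonneg hX.posSemidef.diag_nonneg (sq_nonneg t)) |>.continuousAt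
  refine eq_of_exp_mul_eq_exp_mul (g := fun t => φ (T i i * t ^ 2)) hcont
    (by simp [hX.generator.apply_zero]) fun t => ?_
  rw [← hX.charFun_map_apply, ← hY.charFun_map_apply, h]

theorem IsElliptical.eq_one_or_diag_eq_of_map_apply_eq (hX : IsElliptical X P m S φ)
    (hY : IsElliptical Y Q m T φ)
    (h : ∀ i, P.map (fun ω => X ω i) = Q.map fun ω => Y ω i) :
    (∀ u, 0 ≤ u → φ u = 1) ∨ ∀ i, S i i = T i i := by
  by_contra! hne
  obtain ⟨⟨u, hu, hφu⟩, i, hi⟩ := hne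
  have hscale (u : ℝ) (hu : 0 ≤ u) : φ (S i i * u) = φ (T i i * u) := by
    have hcf : charFun (P.map fun ω => X ω i) √u = charFun (Q.map fun ω => Y ω i) √u := by rw [h]
    rw [hX.charFun_map_apply, hY.charFun_map_apply, Real.sq_sqrt hu] at hcf
    exact_mod_cast mul_left_cancel₀ (Complex.exp_ne_zero _) hcf
  have hcont := hX.generator.continuousOn i.pos 0 Set.self_mem_Ici
  apply hφu
  rw [← hX.generator.apply_zero]
  rcases hi.lt_or_gt with hlt | hlt
  · exact eq_apply_zero_of_apply_mul_eq hcont hX.posSemidef.diag_nonneg hlt hscale hu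
  · exact eq_apply_zero_of_apply_mul_eq hcont hY.posSemidef.diag_nonneg hlt
      (fun u hu => (hscale u hu).symm) hu

variable [IsFiniteMeasure P] [IsFiniteMeasure Q] [IsFiniteMeasure ν]

theorem IsElliptical.isBounded_support_of_eq_one (hX : IsElliptical X P m S φ)
    (hφ : ∀ u, 0 ≤ u → φ u = 1) : Bornology.IsBounded (P.map X).support := by
  have hdirac : P.map X = Measure.dirac m := by
    refine Measure.ext_of_charFun (funext fun t => ?_)
    rw [hX.charFun_eq, hφ _ (hX.dispersion_nonneg t), charFun_dirac, inner_eq_dotProduct,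
      mul_comm Complex.I, Complex.ofReal_one, mul_one]
  rw [hdirac]
  exact Bornology.isBounded_singleton.subset
    (Measure.support_subset_of_isClosed (isClosed_singleton (x := m)) (by simp))

theorem IsElliptical.map_eq (hX : IsElliptical X P m S φ)
    (hν : ∀ t, charFun ν t = (φ (‖t‖ ^ 2) : ℂ)) :
    P.map X = ν.map fun z => m + WithLp.toLp 2 fun i => ⟪gramVectors S i, z⟫ := by
  refine Measure.ext_of_charFun (funext fun t => ?_)
  have hmap : (ν.map fun z => m + WithLp.toLp 2 fun i => ⟪gramVectors S i, z⟫) =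
      (ν.map fun z => WithLp.toLp 2 fun i => ⟪gramVectors S i, z⟫).map fun x => m + x :=
    (Measure.map_map (by fun_prop) (by fun_prop)).symm
  rw [hmap, charFun_map_const_add, charFun_map_inner_eq hν, gram_gramVectors hX.posSemidef,
    hX.charFun_eq, inner_eq_dotProduct, mul_comm, mul_comm Complex.I]

theorem IsElliptical.measure_forall_mem_eq (hX : IsElliptical X P m S φ)
    (hν : ∀ t, charFun ν t = (φ (‖t‖ ^ 2) : ℂ)) (hL : ∀ i, MeasurableSet (L i)) :
    P {ω | ∀ i, X ω i ∈ L i} = boxProb ν S fun i => (m i + ·) ⁻¹' L i := by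
  have hmeas : MeasurableSet {x : EuclideanSpace ℝ (Fin n) | ∀ i, x i ∈ L i} := by
    rw [Set.ofPred_forall]
    exact .iInter fun i => (by fun_prop : Measurable fun x : EuclideanSpace ℝ (Fin n) => x i) (hL i)
  calc P {ω | ∀ i, X ω i ∈ L i} = P.map X {x | ∀ i, x i ∈ L i} :=
        (Measure.map_apply_of_aemeasurable hX.aemeasurable hmeas).symm
    _ = boxProb ν S fun i => (m i + ·) ⁻¹' L i := by
        rw [hX.map_eq hν, Measure.map_apply (by fun_prop) hmeas]
        rfl

theorem IsElliptical.not_isBounded_support (hX : IsElliptical X P m S φ)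
    (hν : ∀ t, charFun ν t = (φ (‖t‖ ^ 2) : ℂ))
    (hb : ¬ Bornology.IsBounded (P.map X).support) : ¬ Bornology.IsBounded ν.support := by
  refine fun h => hb ?_
  set f := fun z => m + WithLp.toLp 2 fun i => ⟪gramVectors S i, z⟫
  have hf : Continuous f := by fun_prop
  have hK : IsCompact (f '' ν.support) :=
    (Metric.isCompact_of_isClosed_isBounded Measure.isClosed_support h).image hf
  refine hK.isBounded.subset (Measure.support_subset_of_isClosed hK.isClosed ?_)
  rw [hX.map_eq hν, mem_ae_map_iff hf.measurable.aemeasurable hK.measurableSet]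
  exact mem_of_superset Measure.support_mem_ae (Set.subset_preimage_image f _)

theorem IsElliptical.measure_forall_mem_le (hX : IsElliptical X P m S φ)
    (hY : IsElliptical Y Q m T φ) (hdiag : ∀ i, S i i = T i i) (hle : ∀ i j, S i j ≤ T i j)
    (hL : ∀ i, IsLowerSet (L i)) : P {ω | ∀ i, X ω i ∈ L i} ≤ Q {ω | ∀ i, Y ω i ∈ L i} := by
  obtain ⟨ν, _, hν⟩ := hX.generator
  have hmeas (i : Fin n) : MeasurableSet (L i) := (hL i).ordConnected.measurableSet
  rw [hX.measure_forall_mem_eq hν hmeas, hY.measure_forall_mem_eq hν hmeas]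
  exact boxProb_le (isRotationInvariant_of_charFun_eq fun s t h => by rw [hν, hν, h])
    (fun i => (hL i).preimage (add_right_mono (a := m i))) hX.posSemidef hY.posSemidef hdiag hle

theorem IsElliptical.measure_forall_mem_lt (hX : IsElliptical X P m S φ)
    (hY : IsElliptical Y Q m T φ) (hν : ∀ t, charFun ν t = (φ (‖t‖ ^ 2) : ℂ))
    (hb : ¬ Bornology.IsBounded ν.support) (hST : (S + T).PosDef) (hdiag : ∀ i, S i i = T i i)
    (hle : ∀ i j, S i j ≤ T i j) {l k : Fin n} (hlt : S l k < T l k) (hL : ∀ i, IsLowerSet (L i))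
    (hne : ∀ i, (L i).Nonempty) (huniv : ∀ i, L i ≠ Set.univ) :
    P {ω | ∀ i, X ω i ∈ L i} < Q {ω | ∀ i, Y ω i ∈ L i} := by
  have hmeas (i : Fin n) : MeasurableSet (L i) := (hL i).ordConnected.measurableSet
  have hsurj (i : Fin n) : Surjective (m i + ·) := (Equiv.addLeft (m i)).surjective
  rw [hX.measure_forall_mem_eq hν hmeas, hY.measure_forall_mem_eq hν hmeas]
  exact boxProb_lt (isRotationInvariant_of_charFun_eq fun s t h => by rw [hν, hν, h]) hb
    (fun i => (hL i).preimage (add_right_mono (a := m i))) (fun i => (hne i).preimage (hsurj i))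
    (fun i => by
      rw [Ne, Set.preimage_eq_univ_iff, (hsurj i).range_eq, Set.univ_subset_iff]
      exact huniv i)
    hX.posSemidef hY.posSemidef hST hdiag hle hlt

end Elliptical

theorem le_of_diag_eq_of_lt_le {ι : Type*} [LinearOrder ι] {S T : Matrix ι ι ℝ}
    (hS : S.IsHermitian) (hT : T.IsHermitian) (hdiag : ∀ i, S i i = T i i)
    (h : ∀ i j, i < j → S i j ≤ T i j) (i j : ι) : S i j ≤ T i j := by
  rcases lt_trichotomy i j with hij | rfl | hij
  · exact h i j hij
  · exact (hdiag i).le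
  · rw [← hS.apply i j, ← hT.apply i j]
    exact h j i hij

theorem theorem4p1 {Ω Ω' : Type*} [MeasurableSpace Ω] [MeasurableSpace Ω']
    (P : Measure Ω) [IsProbabilityMeasure P] (Q : Measure Ω') [IsProbabilityMeasure Q]
    (n : ℕ) (X : Ω → EuclideanSpace ℝ (Fin n)) (Y : Ω' → EuclideanSpace ℝ (Fin n))
    (mx my : EuclideanSpace ℝ (Fin n)) (Sx Sy : Matrix (Fin n) (Fin n) ℝ) (φ : ℝ → ℝ)
    (hX : IsElliptical X P mx Sx φ) (hY : IsElliptical Y Q my Sy φ)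
    (hmarg : ∀ i : Fin n, P.map (fun ω => X ω i) = Q.map (fun ω => Y ω i))
    (hS : ∀ i j : Fin n, i < j → Sx i j ≤ Sy i j) :
    (∀ a : Fin n → ℝ,
      P {ω | ∀ i, X ω i ≤ a i} ≤ Q {ω | ∀ i, Y ω i ≤ a i} ∧
      P {ω | ∀ i, a i < X ω i} ≤ Q {ω | ∀ i, a i < Y ω i}) ∧
    ((∃ i j : Fin n, Sx i j < Sy i j) →
      ¬ Bornology.IsBounded (P.map X).support →
      ¬ Bornology.IsBounded (Q.map Y).support →
      (Sx + Sy).PosDef →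
      ∀ a : Fin n → ℝ,
        P {ω | ∀ i, X ω i ≤ a i} < Q {ω | ∀ i, Y ω i ≤ a i} ∧
        P {ω | ∀ i, a i < X ω i} < Q {ω | ∀ i, a i < Y ω i}) := by
  obtain rfl := hX.location_eq_of_map_apply_eq hY hmarg
  have hdiag := hX.eq_one_or_diag_eq_of_map_apply_eq hY hmarg
  have hle (hdiag : ∀ i, Sx i i = Sy i i) : ∀ i j, Sx i j ≤ Sy i j :=
    le_of_diag_eq_of_lt_le hX.posSemidef.1 hY.posSemidef.1 hdiag hS
  have hneg (Z : EuclideanSpace ℝ (Fin n)) (a : Fin n → ℝ) :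
      (∀ i, a i < Z i) ↔ ∀ i, (-Z) i ∈ Set.Iio (-a i) := by simp
  simp only [hneg, ← Set.mem_Iic]
  refine ⟨fun a => ?_, fun ⟨l, k, hlt⟩ hbX _ hST a => ?_⟩
  · obtain ⟨S, hX, hdiag, hle⟩ : ∃ S, IsElliptical X P mx S φ ∧ (∀ i, S i i = Sy i i) ∧
        ∀ i j, S i j ≤ Sy i j := by
      rcases hdiag with hφ | hdiag
      · exact ⟨Sy, hX.dispersion_congr hφ hY.posSemidef, fun _ => rfl, fun _ _ => le_rfl⟩
      · exact ⟨Sx, hX, hdiag, hle hdiag⟩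
    exact ⟨hX.measure_forall_mem_le hY hdiag hle fun i => isLowerSet_Iic _,
      hX.neg.measure_forall_mem_le hY.neg hdiag hle fun i => isLowerSet_Iio _⟩
  · obtain ⟨ν, _, hν⟩ := hX.generator
    have hb := hX.not_isBounded_support hν hbX
    have hdiag := hdiag.resolve_left fun hφ => hbX (hX.isBounded_support_of_eq_one hφ)
    exact ⟨hX.measure_forall_mem_lt hY hν hb hST hdiag (hle hdiag) hlt (fun i => isLowerSet_Iic _)
        (fun i => Set.nonempty_Iic) fun i =>
          (Set.ne_univ_iff_exists_notMem _).2 (by simpa using exists_gt (a i)),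
      hX.neg.measure_forall_mem_lt hY.neg hν hb hST hdiag (hle hdiag) hlt
        (fun i => isLowerSet_Iio _) (fun i => Set.nonempty_Iio) fun i =>
          (Set.ne_univ_iff_exists_notMem _).2 ⟨_, Set.notMem_Iio.2 le_rfl⟩⟩
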